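/- Let $q$ be a power of a prime $p$ and let $n$ be a positive odd integer with $\gcd(n,q)=1$ such that the multiplicative order $\mathrm{ord}_n(q)$ of $q$ modulo $n$ is odd. Let $\alpha$ be a primitive $n$-th root of unity in an extension field of $\mathbf{F}_{q^2}$. (1) The map $\mu_{-q}: j\mapsto -qj \bmod n$ gives a splitting of $n$ over $\mathbf{F}_{q^2}$: there are disjoint sets $S_0,S_1$ with $S_0\cup S_1=\{1,\dots,n-1\}$, each a union of $q^2$-ary cyclotomic cosets modulo $n$ (that is, stable under multiplication by $q^2$ modulo $n$), such that $-qS_0\equiv S_1$ and $-qS_1\equiv S_0 \pmod n$. (2) Let $\{S_0,S_1\}$ be any such splitting and let $i\in\{0,1\}$. Let $D_i$ be the odd-like duadic code, i.e. the cyclic code of length $n$ over $\mathbf{F}_{q^2}$ consisting of all $c\in\mathbf{F}_{q^2}^n$ whose polynomial $c(x)=\sum_{m=0}^{n-1}c_mx^m$ vanishes at $\alpha^j$ for all $j\in S_i$, and let $C_i=\{c\in D_i : \sum_m c_m=0\}$ be its even-like subcode. Then $C_i^{\perp_h}=D_i$, where $C^{\perp_h}=\{x\in\mathbf{F}_{q^2}^n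 : \sum_m x_m y_m^q=0 \text{ for all } y\in C\}$. (3) For each such splitting and each $i$, the Hermitian construction applied to $D_i$ yields an $[[n,1,d]]_q$ quantum stabilizer code $Q\subseteq\mathbf{C}^{q^n}$ whose minimum distance $d$ equals the minimum Hamming weight of a word in $D_i\setminus C_i$, and $d^2-d+1\ge n$. Here $X(a)Z(b)$, for $a,b\in\mathbf{F}_q^n$, is the error operator on $\mathbf{C}^{q^n}$ given by $X(a)|x\rangle=|x+a\rangle$, $Z(b)|x\rangle=e^{2\pi \mathrm{i}\,\mathrm{tr}(b\cdot x)/p}|x\rangle$ ($\mathrm{tr}$ is the trace $\mathbf{F}_q\to\mathbf{F}_p$); its weight is the number of $m$ with $(a_m,b_m)\ne(0,0)$. A stabilizer code is the joint $+1$-eigenspace of an abelian group $S$ of operators, each of which is a complex number of modulus $1$ times some $X(a)Z(b)$. It is an $[[n,k,d]]_q$ code if it has dimension $q^k$ and $d$ is the largest integer such that $\langle u|E|u\rangle=\langle v|E|v\rangle$ for all error operators $E$ of weight less than $d$ and all unit vectors $u,v$ in the code. It arises from $D$ by the Hermitian construction if, for some basis $(\beta,\gamma)$ of $\mathbf{F}_{q^2}$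 over $\mathbf{F}_q$, the group $S$ can be chosen such that a modulus-one multiple of $X(a)Z(b)$ lies in $S$ exactly when $\beta a+\gamma b\in D^{\perp_h}$. -/

import Mathlib

/-!
  Duadic codes over the field `K` with `q ^ 2` elements, Hermitian duals, and quantum
  stabilizer codes on `n` qudits of dimension `q`.
-/

namespace Duadic

section Codes

/-- `S 0, S 1` is a splitting of `n` over the field with `Q` elements, given by the permutation
`μ_a : i ↦ a * i` of `ZMod n`.  A subset of `ZMod n` is the defining set of a cyclic code of length
`n` over that field iff it is a union of `Q`-ary cyclotomic cosets, i.e. stable under `j ↦ Q * j`.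
The index `i + 1` is computed modulo `2`. -/
structure IsSplitting (n Q : ℕ) (a : ZMod n) (S : Fin 2 → Set (ZMod n)) : Prop where
  isUnit : IsUnit a
  coset : ∀ i, ∀ j ∈ S i, (Q : ZMod n) * j ∈ S i
  disjoint : S 0 ∩ S 1 = ∅
  cover : S 0 ∪ S 1 = {j | j ≠ 0}
  swap : ∀ i, (fun j => a * j) '' S i = S (i + 1)

/-- The cyclic code of length `n` over `K` with defining set `T`, with respect to the `n`-th root of
unity `α` in an extension `L` of `K`: the words `c` whose polynomial `c(x) = ∑ i, c i * x ^ i`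
vanishes at `α ^ j` for all `j ∈ T`. -/
def cyclicCode {n : ℕ} [NeZero n] (K : Type*) {L : Type*} [Field K] [Field L] [Algebra K L]
    (α : L) (T : Set (ZMod n)) : Submodule K (ZMod n → K) where
  carrier := {c | ∀ j ∈ T, ∑ i : ZMod n, algebraMap K L (c i) * (α ^ j.val) ^ i.val = 0}
  zero_mem' := by intro j _; simp
  add_mem' := by
    intro c d hc hd j hj
    have h1 := hc j hj
    have h2 := hd j hj
    simp only [Pi.add_apply, map_add, add_mul, Finset.sum_add_distrib, h1, h2, add_zero]
  smul_mem' := by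
    intro t c hc j hj
    have h1 := hc j hj
    simp only [Pi.smul_apply, smul_eq_mul, map_mul, mul_assoc, ← Finset.mul_sum, h1, mul_zero]

/-- The even-like words (`∑ i, c i = 0`) of a code. -/
def evenLikeSubcode {ι K : Type*} [Fintype ι] [Field K] (D : Submodule K (ι → K)) :
    Submodule K (ι → K) where
  carrier := {c | c ∈ D ∧ ∑ i, c i = 0}
  zero_mem' := ⟨D.zero_mem, by simp⟩
  add_mem' := by
    rintro c d ⟨hc, hc0⟩ ⟨hd, hd0⟩
    exact ⟨D.add_mem hc hd, by simp [Finset.sum_add_distrib, hc0, hd0]⟩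
  smul_mem' := by
    rintro t c ⟨hc, hc0⟩
    exact ⟨D.smul_mem t hc, by simp [← Finset.mul_sum, hc0]⟩

/-- The odd-like duadic code `D_i` attached to the splitting `S`. -/
def oddLike {n : ℕ} [NeZero n] (K : Type*) {L : Type*} [Field K] [Field L] [Algebra K L]
    (α : L) (S : Fin 2 → Set (ZMod n)) (i : Fin 2) : Submodule K (ZMod n → K) :=
  cyclicCode K α (S i)

/-- The even-like duadic code `C_i`: the even-like subcode of `D_i`. -/
def evenLike {n : ℕ} [NeZero n] (K : Type*) {L : Type*} [Field K] [Field L] [Algebra K L]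
    (α : L) (S : Fin 2 → Set (ZMod n)) (i : Fin 2) : Submodule K (ZMod n → K) :=
  evenLikeSubcode (oddLike K α S i)

/-- The Hermitian dual `C^{⊥_h} = {x | ∑ i, x i * (y i) ^ q = 0 for all y ∈ C}` of a code over the
field `K` with `q ^ 2` elements. -/
def hermitianDual {ι K : Type*} [Fintype ι] [Field K] (q : ℕ) (C : Submodule K (ι → K)) :
    Submodule K (ι → K) where
  carrier := {x | ∀ y ∈ C, ∑ i, x i * (y i) ^ q = 0}
  zero_mem' := by intro y _; simp
  add_mem' := by
    intro x z hx hz y hy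
    simp [add_mul, Finset.sum_add_distrib, hx y hy, hz y hy]
  smul_mem' := by
    intro t x hx y hy
    simp [mul_assoc, ← Finset.mul_sum, hx y hy]

end Codes

noncomputable section Quantum

/-- The state space `ℂ^(q^n)` of `n = |ι|` qudits, with orthonormal basis indexed by `F^n`. -/
abbrev States (F ι : Type*) [Fintype F] [Fintype ι] [DecidableEq ι] : Type _ :=
  EuclideanSpace ℂ (ι → F)

variable (p : ℕ) [Fact p.Prime] {F ι : Type*} [Field F] [Fintype F] [Algebra (ZMod p) F]
  [Fintype ι] [DecidableEq ι]

/-- The error operator `X(a) Z(b)`, where `X(a)|x⟩ = |x + a⟩` and `Z(b)|x⟩ = ω^{tr(b·x)}|x⟩` with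
`ω = exp(2πi/p)` and `tr` the trace from `F` to the prime field.  Up to a phase these are the
tensor products of the one-qudit operators `X(a_i) Z(b_i)`. -/
def errorOp (a b : ι → F) : States F ι →ₗ[ℂ] States F ι where
  toFun ψ := WithLp.toLp 2 fun y =>
    (ZMod.stdAddChar (Algebra.trace (ZMod p) F (∑ i, b i * (y i - a i))) : ℂ) * ψ (y - a)
  map_add' ψ φ := by ext y; simp [mul_add]
  map_smul' c ψ := by ext y; simp; ring

/-- The weight of `X(a) Z(b)`: the number of qudits on which it acts nontrivially. -/
def errorWeight [DecidableEq F] (a b : ι → F) : ℕ :=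
  hammingNorm (fun i => (a i, b i))

/-- All errors of weight less than `d` are detected by `Q`: `⟨u|E|u⟩ = ⟨v|E|v⟩` for all
error operators `E` of weight `< d` and all unit vectors `u, v ∈ Q`. -/
def DetectsBelow [DecidableEq F] (Q : Submodule ℂ (States F ι)) (d : ℕ) : Prop :=
  ∀ a b : ι → F, errorWeight a b < d → ∀ u ∈ Q, ∀ v ∈ Q, ‖u‖ = 1 → ‖v‖ = 1 →
    inner ℂ u (errorOp p a b u) = inner ℂ v (errorOp p a b v)

/-- `Q` is the joint `+1`-eigenspace of the group `S`, which is an abelian group of error operators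
(up to phases).  When `Q ≠ 0` the group `S` contains no scalar other than `1`, which forces the
phases to be `p`-th roots of unity (fourth roots of unity if `p = 2`). -/
structure IsStabilizedBy (S : Subgroup (Module.End ℂ (States F ι))ˣ)
    (Q : Submodule ℂ (States F ι)) : Prop where
  error : ∀ E ∈ S, ∃ (c : ℂ) (a b : ι → F), ‖c‖ = 1 ∧
    (E : Module.End ℂ (States F ι)) = c • errorOp p a b
  comm : ∀ E ∈ S, ∀ E' ∈ S, E * E' = E' * E
  mem_iff : ∀ v, v ∈ Q ↔ ∀ E ∈ S, (E : Module.End ℂ (States F ι)) v = v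

/-- `Q` is an `[[n, k, d]]_q` stabilizer code, where `n = |ι|` and `q = |F|`: a stabilizer code of
dimension `q ^ k` with minimum distance exactly `d`. -/
structure IsStabilizerCode [DecidableEq F] (Q : Submodule ℂ (States F ι)) (k d : ℕ) : Prop where
  stabilizer : ∃ S : Subgroup (Module.End ℂ (States F ι))ˣ, IsStabilizedBy p S Q
  dim : Module.finrank ℂ Q = Fintype.card F ^ k
  dist : IsGreatest {δ : ℕ | DetectsBelow p Q δ} d

/-- `Q` is obtained by the Hermitian construction from the code `D` over the quadratic extension
`K` of `F`: for some basis `e 0, e 1` of `K` over `F`, it is a stabilizer code for which the errors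
`X(a) Z(b)` occurring in the stabilizer are exactly those with `a * e 0 + b * e 1 ∈ D^{⊥_h}`. -/
def IsHermitianConstruction {K : Type*} [Field K] [Algebra F K] (D : Submodule K (ι → K))
    (Q : Submodule ℂ (States F ι)) : Prop :=
  ∃ (e : Module.Basis (Fin 2) F K) (S : Subgroup (Module.End ℂ (States F ι))ˣ),
    IsStabilizedBy p S Q ∧
    ∀ a b : ι → F,
      (∃ E ∈ S, ∃ c : ℂ, ‖c‖ = 1 ∧ (E : Module.End ℂ (States F ι)) = c • errorOp p a b) ↔
        (fun i => a i • e 0 + b i • e 1) ∈ hermitianDual (Fintype.card F) D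

end Quantum

end Duadic

/-! Splitting: because `q` has odd order modulo the odd number `n`, no nonzero `j` shares its
`q`-orbit with `-j`, so choosing one orbit from each pair `±` gives halves exchanged by `-q`.

Duality: by Parseval for the Fourier transform on `ZMod n`, the Hermitian product of `x` and `y` is
a sum of products of the transform of `x` at `j` with a `q`-th power of the transform of `y` at `k`,
where `j = -qk`. Since `-q` swaps the halves, all terms vanish for `x ∈ D`, `y ∈ C`. Conversely,
words built from the field trace (as in Delsarte's theorem) lie in `C` and test every frequency in
`S i`. A dimension count then gives `D^⊥ = C`.

Quantum code: in coordinates over `F`, Hermitian duality becomes trace-symplectic duality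
(`traceChar_sympForm_eq_one_iff`), so the errors labelled by `C` commute and can be given phases
forming a group (`exists_isErrorRep`). Traces give the dimension of the fixed space, and the
undetected errors are those labelled by `D \ C` (`IsErrorRep.detects_iff`).

Bound: for `c ∈ D \ C` every Hermitian autocorrelation equals one nonzero constant, so the
differences of the support of `c` cover `ZMod n`. -/

namespace Duadic

/-! ### Existence of a splitting -/

/-- The least representative of the orbit of `j` under multiplication by `q`. -/
noncomputable def leastCosetRep (n q : ℕ) (j : ZMod n) : ℕ :=
  sInf (Set.range fun t : ℕ => ((q : ZMod n) ^ t * j).val)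

lemma exists_leastCosetRep_eq (n q : ℕ) (j : ZMod n) :
    ∃ t : ℕ, ((q : ZMod n) ^ t * j).val = leastCosetRep n q j :=
  Nat.sInf_mem (Set.range_nonempty fun t : ℕ => ((q : ZMod n) ^ t * j).val)

lemma leastCosetRep_mul {n q : ℕ} (h : 0 < orderOf (q : ZMod n)) (j : ZMod n) :
    leastCosetRep n q (q * j) = leastCosetRep n q j := by
  unfold leastCosetRep
  congr 1
  ext m
  constructor
  · rintro ⟨t, rfl⟩
    exact ⟨t + 1, by simp only [pow_succ, mul_assoc]⟩
  · rintro ⟨t, rfl⟩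
    -- As the order is positive, `q ^ (order - 1)` undoes multiplication by `q`.
    refine ⟨t + (orderOf (q : ZMod n) - 1), ?_⟩
    have e : (q : ZMod n) ^ (t + (orderOf (q : ZMod n) - 1)) * (q * j) = (q : ZMod n) ^ t * j := by
      rw [← mul_assoc, ← pow_succ, add_assoc, Nat.sub_add_cancel h, pow_add, pow_orderOf_eq_one,
        mul_one]
    simp only [e]

/-- Equal representatives give `q ^ s * j = -(q ^ t * j)`. Iterating this as often as the odd order
of `q` removes the powers of `q` and keeps the sign: `j = -j`, where `2` is a unit. -/
lemma eq_zero_of_leastCosetRep_neg {n q : ℕ} [NeZero n] (hn : Odd n)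
    (hord : Odd (orderOf (q : ZMod n))) {j : ZMod n}
    (h : leastCosetRep n q j = leastCosetRep n q (-j)) : j = 0 := by
  obtain ⟨s, hs⟩ := exists_leastCosetRep_eq n q j
  obtain ⟨t, ht⟩ := exists_leastCosetRep_eq n q (-j)
  rw [h, ← ht] at hs
  have e : (q : ZMod n) ^ s * j = -((q : ZMod n) ^ t * j) := by
    rw [ZMod.val_injective n hs]; ring
  set r := orderOf (q : ZMod n)
  have hr : (q : ZMod n) ^ r = 1 := pow_orderOf_eq_one _
  have key : ∀ k : ℕ, ((q : ZMod n) ^ s) ^ k * j = (-1) ^ k * (((q : ZMod n) ^ t) ^ k * j) := by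
    intro k
    induction k with
    | zero => simp
    | succ k ih =>
      calc ((q : ZMod n) ^ s) ^ (k + 1) * j = (q : ZMod n) ^ s * (((q : ZMod n) ^ s) ^ k * j) := by
            ring
        _ = (-1) ^ k * ((q : ZMod n) ^ t) ^ k * ((q : ZMod n) ^ s * j) := by rw [ih]; ring
        _ = _ := by rw [e]; ring
  have hk := key r
  rw [← pow_mul, ← pow_mul, mul_comm s, mul_comm t, pow_mul, pow_mul, hr, one_pow, one_pow,
    hord.neg_one_pow] at hk
  have h2 : (2 : ZMod n) * j = 0 := by linear_combination hk
  have hu : IsUnit ((2 : ℕ) : ZMod n) :=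
    (ZMod.isUnit_iff_coprime 2 n).2 (Nat.coprime_two_left.2 hn)
  exact (hu.mul_right_eq_zero).1 (by exact_mod_cast h2)

theorem exists_isSplitting_neg (q n : ℕ) [NeZero n] (hn : Odd n) (hnq : Nat.Coprime n q)
    (hord : Odd (orderOf (q : ZMod n))) :
    ∃ S : Fin 2 → Set (ZMod n), IsSplitting n (q ^ 2) (-(q : ZMod n)) S := by
  have hpos := hord.pos
  have hu : IsUnit (q : ZMod n) := (ZMod.isUnit_iff_coprime q n).2 hnq.symm
  have hua : IsUnit (-(q : ZMod n)) := hu.neg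
  have hc : ∀ j : ZMod n, leastCosetRep n q (q * j) = leastCosetRep n q j := leastCosetRep_mul hpos
  have hc' : ∀ j : ZMod n, leastCosetRep n q (-(q * j)) = leastCosetRep n q (-j) := by
    intro j; rw [← mul_neg, hc]
  -- The representative is constant on `q`-orbits, so multiplication by `-q` acts on this comparison
  -- as negation does and swaps `A` with `B`.
  set A : Set (ZMod n) := {j | leastCosetRep n q j < leastCosetRep n q (-j)}
  set B : Set (ZMod n) := {j | leastCosetRep n q (-j) < leastCosetRep n q j}
  have hA : ∀ j : ZMod n, (q : ZMod n) * j ∈ A ↔ j ∈ A := by intro j; simp [A, hc, hc']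
  have hB : ∀ j : ZMod n, (q : ZMod n) * j ∈ B ↔ j ∈ B := by intro j; simp [B, hc, hc']
  have hAB : ∀ j : ZMod n, -(q : ZMod n) * j ∈ A ↔ j ∈ B := by intro j; simp [A, B, hc, hc']
  have hBA : ∀ j : ZMod n, -(q : ZMod n) * j ∈ B ↔ j ∈ A := by intro j; simp [A, B, hc, hc']
  have himage : ∀ U V : Set (ZMod n), (∀ j : ZMod n, -(q : ZMod n) * j ∈ V ↔ j ∈ U) →
      (fun j => -(q : ZMod n) * j) '' U = V := by
    intro U V h
    ext j
    constructor
    · rintro ⟨k, hk, rfl⟩; exact (h k).2 hk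
    · intro hj
      obtain ⟨v, hv⟩ := hua
      have e : -(q : ZMod n) * (↑v⁻¹ * j) = j := by rw [← hv, Units.mul_inv_cancel_left]
      exact ⟨↑v⁻¹ * j, (h _).1 (by rwa [e]), e⟩
  refine ⟨![A, B], hua, ?_, ?_, ?_, ?_⟩
  · intro i j hj
    have e : ((q ^ 2 : ℕ) : ZMod n) * j = q * (q * j) := by push_cast; ring
    rw [e]
    fin_cases i
    · exact (hA _).2 ((hA _).2 hj)
    · exact (hB _).2 ((hB _).2 hj)
  · change A ∩ B = ∅
    refine Set.disjoint_iff_inter_eq_empty.1 (Set.disjoint_left.2 fun j h1 h2 => ?_)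
    simp only [A, B, Set.mem_ofPred_eq] at h1 h2
    exact lt_asymm h1 h2
  · ext j
    change (leastCosetRep n q j < leastCosetRep n q (-j) ∨
      leastCosetRep n q (-j) < leastCosetRep n q j) ↔ j ≠ 0
    rw [← ne_iff_lt_or_gt]
    refine not_congr ⟨eq_zero_of_leastCosetRep_neg hn hord, ?_⟩
    rintro rfl; simp
  · intro i
    fin_cases i
    · exact himage A B hBA
    · exact himage B A hAB

/-! ### Fourier transform on `ZMod n` -/

section Transform

variable {n : ℕ} [NeZero n] {K L : Type*} [Field K] [Field L] [Algebra K L]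

/-- The additive character `j ↦ α ^ j` of `ZMod n`. -/
def rootChar {α : L} (hα : IsPrimitiveRoot α n) : AddChar (ZMod n) L :=
  AddChar.zmodChar n hα.pow_eq_one

lemma rootChar_mul {α : L} (hα : IsPrimitiveRoot α n) (i j : ZMod n) :
    rootChar hα (i * j) = (α ^ i.val) ^ j.val := by
  rw [rootChar, AddChar.zmodChar_apply, ZMod.val_mul, ← pow_mul]
  exact (pow_eq_pow_mod _ hα.pow_eq_one).symm

lemma sum_rootChar_mul {α : L} (hα : IsPrimitiveRoot α n) (b : ZMod n) :
    ∑ x, rootChar hα (x * b) = if b = 0 then (n : L) else 0 := by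
  have h := AddChar.sum_mulShift b (AddChar.zmodChar_primitive_of_primitive_root n hα)
  rw [ZMod.card] at h
  simpa [rootChar] using h

/-- The discrete Fourier transform of `f` with respect to the root of unity `α`. -/
def rootTransform {α : L} (hα : IsPrimitiveRoot α n) (f : ZMod n → L) (j : ZMod n) : L :=
  ∑ m, f m * rootChar hα (j * m)

lemma mem_cyclicCode_iff {α : L} (hα : IsPrimitiveRoot α n) {T : Set (ZMod n)}
    {c : ZMod n → K} :
    c ∈ cyclicCode K α T ↔ ∀ j ∈ T, rootTransform hα (fun m => algebraMap K L (c m)) j = 0 := by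
  simp only [rootTransform, rootChar_mul]
  rfl

lemma rootTransform_zero {α : L} (hα : IsPrimitiveRoot α n) (f : ZMod n → L) :
    rootTransform hα f 0 = ∑ m, f m := by
  simp [rootTransform]

/-- Parseval's identity, from orthogonality of characters. -/
lemma sum_rootTransform_mul {α : L} (hα : IsPrimitiveRoot α n) (f g : ZMod n → L) :
    ∑ j, rootTransform hα f j * rootTransform hα g (-j) = n * ∑ m, f m * g m := by
  calc ∑ j, rootTransform hα f j * rootTransform hα g (-j)
      = ∑ j, ∑ m, ∑ k, f m * g k * rootChar hα (j * (m - k)) := by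
        refine Finset.sum_congr rfl fun j _ => ?_
        rw [rootTransform, rootTransform, Finset.sum_mul_sum]
        refine Finset.sum_congr rfl fun m _ => Finset.sum_congr rfl fun k _ => ?_
        rw [mul_sub, sub_eq_add_neg, ← neg_mul, AddChar.map_add_eq_mul]
        ring
    _ = ∑ m, ∑ k, f m * g k * ∑ j, rootChar hα (j * (m - k)) := by
        rw [Finset.sum_comm]
        refine Finset.sum_congr rfl fun m _ => ?_
        rw [Finset.sum_comm]
        simp only [Finset.mul_sum]
    _ = n * ∑ m, f m * g m := by
        rw [Finset.mul_sum]
        refine Finset.sum_congr rfl fun m _ => ?_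
        simp only [sum_rootChar_mul, sub_eq_zero]
        simp [mul_comm]

/-- Frobenius moves frequency `j` to `p ^ s * j`; this is how conjugating a word acts on its zeros.
-/
lemma rootTransform_pow {α : L} (hα : IsPrimitiveRoot α n) (p s : ℕ) [ExpChar L p]
    (f : ZMod n → L) (j : ZMod n) :
    rootTransform hα (fun m => f m ^ p ^ s) (((p ^ s : ℕ) : ZMod n) * j)
      = rootTransform hα f j ^ p ^ s := by
  rw [rootTransform, rootTransform, sum_pow_char_pow]
  refine Finset.sum_congr rfl fun m _ => ?_
  rw [mul_pow, ← AddChar.map_nsmul_eq_pow, nsmul_eq_mul, mul_assoc]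

/-- Allows `L` to be replaced by the finite field generated by the root of unity. -/
lemma cyclicCode_algebraMap {M : Type*} [Field M] [Algebra K M] [Algebra M L]
    [IsScalarTower K M L] (α : M) (T : Set (ZMod n)) :
    cyclicCode K (algebraMap M L α) T = cyclicCode K α T := by
  ext c
  refine forall₂_congr fun j _ => ?_
  rw [← map_eq_zero_iff (algebraMap M L) (algebraMap M L).injective]
  simp [IsScalarTower.algebraMap_apply K M L]

lemma const_one_mem_cyclicCode {α : L} (hα : IsPrimitiveRoot α n) {T : Set (ZMod n)}
    (hT : (0 : ZMod n) ∉ T) : (fun _ => 1) ∈ cyclicCode K α T := by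
  rw [mem_cyclicCode_iff hα]
  intro j hj
  have h := sum_rootChar_mul hα j
  rw [if_neg (by rintro rfl; exact hT hj)] at h
  simpa [rootTransform, mul_comm] using h

lemma comp_add_mem_cyclicCode {α : L} (hα : IsPrimitiveRoot α n) {T : Set (ZMod n)}
    {c : ZMod n → K} (hc : c ∈ cyclicCode K α T) (a : ZMod n) :
    (fun m => c (m + a)) ∈ cyclicCode K α T := by
  rw [mem_cyclicCode_iff hα] at hc ⊢
  intro j hj
  have h := hc j hj
  rw [rootTransform, ← Equiv.sum_comp (Equiv.addRight a)] at h
  simp only [Equiv.coe_addRight, mul_add, AddChar.map_add_eq_mul, ← mul_assoc] at h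
  rw [← Finset.sum_mul] at h
  exact (mul_eq_zero.1 h).resolve_right (AddChar.val_isUnit _ _).ne_zero

end Transform

/-! ### Elementary properties of splittings -/

section Splitting

variable {n : ℕ}

lemma IsSplitting.zero_notMem {Q : ℕ} {a : ZMod n} {S : Fin 2 → Set (ZMod n)}
    (hS : IsSplitting n Q a S) (i : Fin 2) : (0 : ZMod n) ∉ S i := by
  intro h
  have : (0 : ZMod n) ∈ S 0 ∪ S 1 := by
    fin_cases i
    · exact Or.inl h
    · exact Or.inr h
  rw [hS.cover] at this
  exact this rfl

lemma IsSplitting.notMem_add_one {Q : ℕ} {a : ZMod n} {S : Fin 2 → Set (ZMod n)}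
    (hS : IsSplitting n Q a S) {i : Fin 2} {j : ZMod n} (h : j ∈ S i) : j ∉ S (i + 1) := by
  intro h'
  have : j ∈ S 0 ∩ S 1 := by
    fin_cases i
    · exact ⟨h, h'⟩
    · exact ⟨h', h⟩
  rw [hS.disjoint] at this
  exact this

lemma IsSplitting.mem_or_mem {Q : ℕ} {a : ZMod n} {S : Fin 2 → Set (ZMod n)}
    (hS : IsSplitting n Q a S) (i : Fin 2) {j : ZMod n} (h : j ≠ 0) :
    j ∈ S i ∨ j ∈ S (i + 1) := by
  have : j ∈ S 0 ∪ S 1 := by rw [hS.cover]; exact h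
  fin_cases i
  · exact this
  · exact this.symm

lemma IsSplitting.exists_mul_eq {Q : ℕ} {a : ZMod n} {S : Fin 2 → Set (ZMod n)}
    (hS : IsSplitting n Q a S) {i : Fin 2} {j : ZMod n} (h : j ∈ S (i + 1)) :
    ∃ k ∈ S i, a * k = j := by
  rw [← hS.swap i] at h
  exact h

lemma IsSplitting.pow_mul_mem {Q : ℕ} {a : ZMod n} {S : Fin 2 → Set (ZMod n)}
    (hS : IsSplitting n Q a S) {i : Fin 2} {j : ZMod n} (h : j ∈ S i) (t : ℕ) :
    ((Q ^ t : ℕ) : ZMod n) * j ∈ S i := by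
  induction t with
  | zero => simpa
  | succ t ih =>
    have := hS.coset i _ ih
    rwa [← mul_assoc, ← Nat.cast_mul, ← pow_succ'] at this

end Splitting

/-! ### Hermitian dual of the even-like code -/

section HermitianDual

variable {n : ℕ} [NeZero n] {K L : Type*} [Field K] [Field L] [Algebra K L]

/-- Every Parseval term vanishes: on `S i` because of `x`, at `0` because `y` is even-like, and at
`j = -qk` with `k ∈ S i` because the conjugate of `y` has transform at `qk` equal to the `q`-th
power of that of `y` at `k`. -/
lemma oddLike_le_hermitianDual_evenLike (p s : ℕ) [ExpChar L p] {α : L}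
    (hα : IsPrimitiveRoot α n) (hn : (n : L) ≠ 0) {S : Fin 2 → Set (ZMod n)} {Q : ℕ}
    (hS : IsSplitting n Q (-((p ^ s : ℕ) : ZMod n)) S) (i : Fin 2) :
    oddLike K α S i ≤ hermitianDual (p ^ s) (evenLike K α S i) := by
  rintro x hx y ⟨hy, hy0⟩
  rw [oddLike, mem_cyclicCode_iff hα] at hx
  replace hy := (mem_cyclicCode_iff hα).1 hy
  have h := sum_rootTransform_mul hα (fun m => algebraMap K L (x m))
    (fun m => algebraMap K L (y m) ^ p ^ s)
  rw [Finset.sum_eq_zero] at h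
  · have h' := (mul_eq_zero.1 h.symm).resolve_left hn
    rw [← map_eq_zero_iff (algebraMap K L) (algebraMap K L).injective]
    simpa using h'
  · intro j _
    by_cases hj : j = 0
    · subst hj
      rw [neg_zero]
      rw [rootTransform_zero hα (fun m => algebraMap K L (y m) ^ p ^ s), ← sum_pow_char_pow,
        ← map_sum, hy0]
      simp [expChar_pos L p |>.ne']
    · rcases hS.mem_or_mem i hj with h1 | h1
      · rw [hx j h1, zero_mul]
      · obtain ⟨k, hk, rfl⟩ := hS.exists_mul_eq h1
        rw [neg_mul, neg_neg, rootTransform_pow, hy k hk,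
          zero_pow (pow_ne_zero _ (expChar_pos L p).ne'), mul_zero]

/-- The trace is a sum of conjugates, and the `t`-th conjugate is a pure wave seen only at frequency
`|K| ^ t * k`. The spectrum of the trace word therefore lies in the cyclotomic coset of `k`. -/
lemma rootTransform_trace [Fintype K] [Finite L] {α : L} (hα : IsPrimitiveRoot α n) (l : L) {k j : ZMod n}
    (h : ∀ t : ℕ, ((Fintype.card K ^ t : ℕ) : ZMod n) * k ≠ j) :
    rootTransform hα
      (fun m => algebraMap K L (Algebra.trace K L (l * rootChar hα (-(k * m))))) j = 0 := by
  simp only [rootTransform, FiniteField.algebraMap_trace_eq_sum_pow, Finset.sum_mul]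
  rw [Finset.sum_comm]
  refine Finset.sum_eq_zero fun t _ => ?_
  have e : ∀ m : ZMod n, (l * rootChar hα (-(k * m))) ^ Nat.card K ^ t * rootChar hα (j * m)
      = l ^ Nat.card K ^ t *
        rootChar hα (m * (j - ((Fintype.card K ^ t : ℕ) : ZMod n) * k)) := by
    intro m
    rw [mul_pow, ← AddChar.map_nsmul_eq_pow, mul_assoc, ← AddChar.map_add_eq_mul,
      Nat.card_eq_fintype_card, nsmul_eq_mul]
    congr 2
    ring
  simp only [e]
  rw [← Finset.mul_sum, sum_rootChar_mul, if_neg (sub_ne_zero.2 (h t).symm), mul_zero]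

lemma trace_pow_char_pow [Finite L] (p s : ℕ) [ExpChar K p] [ExpChar L p] (z : L) :
    Algebra.trace K L z ^ p ^ s = Algebra.trace K L (z ^ p ^ s) := by
  apply (algebraMap K L).injective
  rw [map_pow, FiniteField.algebraMap_trace_eq_sum_pow, FiniteField.algebraMap_trace_eq_sum_pow,
    sum_pow_char_pow]
  simp only [← pow_mul, mul_comm]

/-- Write `j ∈ S i` as `-qk` with `k ∈ S (i + 1)`. The coset of `k` avoids `S i` and `0`, so its
trace words lie in `C`. Pairing them with `x` gives `Tr (w * l ^ q) = 0` for all `l`, where `w` is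
the transform of `x` at `j`. As `l ^ q` runs over all of `L`, nondegeneracy of the trace forces `w =
0`. -/
lemma hermitianDual_evenLike_le_oddLike_of_finite [Fintype K] [Finite L] (p s : ℕ) [ExpChar K p]
    [ExpChar L p] {α : L} (hα : IsPrimitiveRoot α n) {S : Fin 2 → Set (ZMod n)}
    (hS : IsSplitting n (Fintype.card K) (-((p ^ s : ℕ) : ZMod n)) S) (i : Fin 2) :
    hermitianDual (p ^ s) (evenLike K α S i) ≤ oddLike K α S i := by
  intro x hx
  rw [oddLike, mem_cyclicCode_iff hα]
  intro j hj
  have hj' : j ∈ S (i + 1 + 1) := by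
    rw [add_assoc]; simpa using hj
  obtain ⟨k, hk, rfl⟩ := hS.exists_mul_eq hj'
  set w := rootTransform hα (fun m => algebraMap K L (x m)) (-((p ^ s : ℕ) : ZMod n) * k) with hw
  by_contra hw0
  have htr : ∀ l : L, Algebra.trace K L (w * l ^ p ^ s) = 0 := by
    intro l
    have hy : (fun m => Algebra.trace K L (l * rootChar hα (-(k * m)))) ∈ evenLike K α S i := by
      refine ⟨(mem_cyclicCode_iff hα).2 fun j hj => rootTransform_trace hα l fun t ht => ?_, ?_⟩
      · exact hS.notMem_add_one hj (ht ▸ hS.pow_mul_mem hk t)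
      · rw [← map_eq_zero_iff (algebraMap K L) (algebraMap K L).injective, map_sum,
          ← rootTransform_zero hα]
        refine rootTransform_trace hα l fun t ht => ?_
        exact hS.zero_notMem (i + 1) (ht ▸ hS.pow_mul_mem hk t)
    have h := hx _ hy
    simp only [trace_pow_char_pow, ← smul_eq_mul (a := x _)] at h
    simp only [← map_smul, ← map_sum] at h
    rw [← h, hw, rootTransform, Finset.sum_mul]
    congr 1
    refine Finset.sum_congr rfl fun m _ => ?_
    rw [Algebra.smul_def, mul_pow, ← AddChar.map_nsmul_eq_pow, nsmul_eq_mul, mul_neg, neg_mul,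
      mul_assoc]
    ring_nf
  obtain ⟨u, hu⟩ := Algebra.trace_surjective K L 1
  obtain ⟨l, hl⟩ : ∃ l : L, l ^ p ^ s = w⁻¹ * u :=
    (Finite.injective_iff_surjective (f := iterateFrobenius L p s)).1
      (iterateFrobenius L p s).injective _
  have := htr l
  rw [hl, mul_inv_cancel_left₀ hw0, hu] at this
  exact one_ne_zero this

open scoped IntermediateField in
theorem hermitianDual_evenLike [Fintype K] (p s : ℕ) [ExpChar K p] {α : L}
    (hα : IsPrimitiveRoot α n) (hn : (n : L) ≠ 0) {S : Fin 2 → Set (ZMod n)}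
    (hS : IsSplitting n (Fintype.card K) (-((p ^ s : ℕ) : ZMod n)) S) (i : Fin 2) :
    hermitianDual (p ^ s) (evenLike K α S i) = oddLike K α S i := by
  have : ExpChar L p := expChar_of_injective_algebraMap (algebraMap K L).injective p
  refine le_antisymm ?_ (oddLike_le_hermitianDual_evenLike p s hα hn hS i)
  have hint : IsIntegral K α := (hα.isIntegral (NeZero.pos n)).tower_top
  have hfd : FiniteDimensional K K⟮α⟯ := IntermediateField.adjoin.finiteDimensional hint
  have hfin : Finite K⟮α⟯ := Module.finite_of_finite K
  have : ExpChar K⟮α⟯ p := expChar_of_injective_algebraMap (algebraMap K K⟮α⟯).injective p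
  let β : K⟮α⟯ := IntermediateField.AdjoinSimple.gen K α
  have hβα : algebraMap K⟮α⟯ L β = α := IntermediateField.AdjoinSimple.algebraMap_gen K α
  have hβ : IsPrimitiveRoot β n :=
    IsPrimitiveRoot.of_map_of_injective (f := algebraMap K⟮α⟯ L) (by rwa [hβα])
      (algebraMap K⟮α⟯ L).injective
  have e : oddLike K α S i = oddLike K β S i := by
    rw [oddLike, oddLike, ← cyclicCode_algebraMap (L := L) β, hβα]
  rw [evenLike, e]
  exact hermitianDual_evenLike_le_oddLike_of_finite p s hβ hS i

end HermitianDual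

/-! ### Dimensions and the dual of the odd-like code -/

section Dimension

variable {ι K : Type*} [Fintype ι] [Field K]

lemma mul_pow_sum_comm [Fintype K] {p s : ℕ} [ExpChar K p]
    (hK : Fintype.card K = (p ^ s) ^ 2) (x y : ι → K) :
    (∑ i, x i * y i ^ p ^ s) ^ p ^ s = ∑ i, y i * x i ^ p ^ s := by
  rw [sum_pow_char_pow]
  refine Finset.sum_congr rfl fun i _ => ?_
  rw [mul_pow, ← pow_mul, ← sq, ← hK, FiniteField.pow_card, mul_comm]

lemma le_hermitianDual_hermitianDual [Fintype K] {p s : ℕ} [ExpChar K p]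
    (hK : Fintype.card K = (p ^ s) ^ 2) (C : Submodule K (ι → K)) :
    C ≤ hermitianDual (p ^ s) (hermitianDual (p ^ s) C) := by
  intro x hx y hy
  rw [← mul_pow_sum_comm hK, hy x hx, zero_pow (pow_ne_zero _ (expChar_pos K p).ne')]

/-- The Hermitian dual of `C` is the orthogonal, for the dot product, of the Frobenius image `C'` of
`C`. Frobenius is only semilinear, so equality of dimensions is read off from cardinalities. -/
lemma finrank_hermitianDual_add [Finite K] (p s : ℕ) [ExpChar K p] (C : Submodule K (ι → K)) :
    Module.finrank K (hermitianDual (p ^ s) C) + Module.finrank K C = Fintype.card ι := by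
  classical
  have : Fintype K := Fintype.ofFinite K
  let σ : K ≃+* K := RingEquiv.ofBijective (iterateFrobenius K p s)
    ⟨(iterateFrobenius K p s).injective,
      Finite.injective_iff_surjective.1 (iterateFrobenius K p s).injective⟩
  have hσ : ∀ z, σ z = z ^ p ^ s := fun z => rfl
  let C' : Submodule K (ι → K) :=
    { carrier := {y | (fun i => σ.symm (y i)) ∈ C}
      zero_mem' := by
        have h : (fun i => σ.symm ((0 : ι → K) i)) = 0 := by ext; simp
        change (fun i => σ.symm ((0 : ι → K) i)) ∈ C
        rw [h]
        exact C.zero_mem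
      add_mem' := by
        intro a b ha hb
        have h : (fun i => σ.symm ((a + b) i)) = (fun i => σ.symm (a i)) + fun i => σ.symm (b i) := by
          ext; simp
        change (fun i => σ.symm ((a + b) i)) ∈ C
        rw [h]
        exact C.add_mem ha hb
      smul_mem' := by
        intro t a ha
        have h : (fun i => σ.symm ((t • a) i)) = σ.symm t • fun i => σ.symm (a i) := by
          ext; simp
        change (fun i => σ.symm ((t • a) i)) ∈ C
        rw [h]
        exact C.smul_mem (σ.symm t) ha }
  have hcard : Nat.card C' = Nat.card C := by
    refine Nat.card_congr
      { toFun := fun y => ⟨fun i => σ.symm (y.1 i), y.2⟩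
        invFun := fun x => ⟨fun i => σ (x.1 i), ?_⟩
        left_inv := fun y => by simp
        right_inv := fun x => by simp }
    change (fun i => σ.symm (σ (x.1 i))) ∈ C
    simp
  have hrank : Module.finrank K C' = Module.finrank K C := by
    rw [Nat.card_eq_fintype_card, Nat.card_eq_fintype_card, Module.card_eq_pow_finrank (K := K) (V := C'),
      Module.card_eq_pow_finrank (K := K) (V := C)] at hcard
    exact Nat.pow_right_injective (Fintype.one_lt_card (α := K)) hcard
  let B := Matrix.toBilin' (1 : Matrix ι ι K)
  have hB : B.Nondegenerate :=
    Matrix.Nondegenerate.toBilin' (Matrix.nondegenerate_of_det_ne_zero (by simp))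
  have hdual : hermitianDual (p ^ s) C = B.orthogonal C' := by
    ext x
    rw [LinearMap.BilinForm.mem_orthogonal_iff]
    constructor
    · intro hx y hy
      have := hx _ hy
      simp only [← hσ, RingEquiv.apply_symm_apply] at this
      simpa [B, Matrix.toBilin'_apply', dotProduct, mul_comm] using this
    · intro hx y hy
      have := hx (fun i => σ (y i)) (show (fun i => σ.symm (σ (y i))) ∈ C by simpa using hy)
      simpa [B, Matrix.toBilin'_apply', dotProduct, mul_comm, hσ]
        using this
  have hle := Submodule.finrank_le C'
  rw [hdual, LinearMap.BilinForm.finrank_orthogonal hB, hrank]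
  rw [hrank] at hle
  rw [Nat.sub_add_cancel hle, Module.finrank_fintype_fun_eq_card]

lemma finrank_evenLikeSubcode_add_one {D : Submodule K (ι → K)} {x : ι → K} (hx : x ∈ D)
    (hx0 : ∑ i, x i ≠ 0) :
    Module.finrank K (evenLikeSubcode D) + 1 = Module.finrank K D := by
  let f : (ι → K) →ₗ[K] K := ∑ i, LinearMap.proj i
  have hf : ∀ c, f c = ∑ i, c i := by simp [f]
  let g := f.domRestrict D
  have hker : (LinearMap.ker g).map D.subtype = evenLikeSubcode D := by
    ext c
    constructor
    · rintro ⟨⟨c, hc⟩, h, rfl⟩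
      exact ⟨hc, (hf c).symm.trans h⟩
    · rintro ⟨hc, h⟩
      exact ⟨⟨c, hc⟩, (hf c).trans h, rfl⟩
  have hsurj : LinearMap.range g = ⊤ :=
    LinearMap.range_eq_top.2 (LinearMap.surjective fun h => hx0 (by
      rw [← hf]; exact LinearMap.congr_fun h ⟨x, hx⟩))
  have := LinearMap.finrank_range_add_finrank_ker g
  rw [hsurj, finrank_top, Module.finrank_self] at this
  rw [← hker, Submodule.finrank_map_subtype_eq, ← this, add_comm]

lemma evenLikeSubcode_le (D : Submodule K (ι → K)) : evenLikeSubcode D ≤ D := fun _ h => h.1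

/-- Biduality gives one inclusion, and both sides have codimension equal to the dimension of `D`. -/
lemma hermitianDual_eq_evenLikeSubcode [Fintype K] {p s : ℕ} [ExpChar K p]
    (hK : Fintype.card K = (p ^ s) ^ 2) {D : Submodule K (ι → K)}
    (hD : hermitianDual (p ^ s) (evenLikeSubcode D) = D) :
    hermitianDual (p ^ s) D = evenLikeSubcode D := by
  have h1 := finrank_hermitianDual_add p s D
  have h2 := finrank_hermitianDual_add p s (evenLikeSubcode D)
  rw [hD] at h2
  have hle := le_hermitianDual_hermitianDual hK (evenLikeSubcode D)
  rw [hD] at hle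
  exact (Submodule.eq_of_le_of_finrank_eq hle (by omega)).symm

end Dimension

/-! ### The square root bound -/

section SquareRootBound

variable {n : ℕ} [NeZero n] {K L : Type*} [Field K] [Field L] [Algebra K L]

open Finset in
/-- If every autocorrelation of `c` is nonzero, then the support of `c` is a difference cover. -/
lemma card_le_hammingNorm_of_autocorrelation {ι : Type*} [Fintype ι] [DecidableEq ι] [AddCommGroup ι]
    [DecidableEq K] {c c' : ι → K} (hc : ∀ i, c' i ≠ 0 → c i ≠ 0)
    (h : ∀ m, ∑ k, c (k + m) * c' k ≠ 0) :
    (Fintype.card ι : ℤ) ≤ (hammingNorm c : ℤ) ^ 2 - hammingNorm c + 1 := by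
  set T : Finset ι := univ.filter fun i => c i ≠ 0
  have hT : hammingNorm c = #T := rfl
  -- A nonzero term at shift `m` exhibits `m` as a difference of two support elements; ordered pairs
  -- of distinct elements number `d ^ 2 - d`, and `0` adds one.
  have hsub : (univ : Finset ι) ⊆ insert 0 (T.offDiag.image fun x => x.1 - x.2) := by
    intro m _
    obtain ⟨k, -, hk⟩ := Finset.exists_ne_zero_of_sum_ne_zero (h m)
    rw [mem_insert, mem_image]
    by_cases hm : m = 0
    · exact Or.inl hm
    · refine Or.inr ⟨(k + m, k), ?_, by simp⟩
      rw [mem_offDiag]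
      exact ⟨by simp [T, left_ne_zero_of_mul hk], by simp [T, hc k (right_ne_zero_of_mul hk)],
        by simpa using hm⟩
  have h1 := (card_le_card hsub).trans ((card_insert_le _ _).trans
    (Nat.add_le_add_right card_image_le 1))
  rw [offDiag_card, card_univ] at h1
  rw [hT]
  have h2 : #T ≤ #T * #T := Nat.le_mul_self _
  zify [h2] at h1
  linarith

/-- A shift of `c` minus `c` is even-like, hence orthogonal to `c`, so the autocorrelation does not
depend on the shift. Its sum over all shifts is `(∑ c) * (∑ c) ^ q ≠ 0`, so the constant is nonzero.
-/
lemma card_le_of_mem_oddLike_diff_evenLike [DecidableEq K] (p s : ℕ) [ExpChar K p] {α : L}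
    (hα : IsPrimitiveRoot α n) {S : Fin 2 → Set (ZMod n)} {i : Fin 2}
    (hC : evenLike K α S i ≤ hermitianDual (p ^ s) (oddLike K α S i)) {c : ZMod n → K}
    (hc : c ∈ oddLike K α S i) (hc0 : c ∉ evenLike K α S i) :
    (n : ℤ) ≤ (hammingNorm c : ℤ) ^ 2 - hammingNorm c + 1 := by
  have hsum : ∑ m, c m ≠ 0 := fun h => hc0 ⟨hc, h⟩
  have hq : p ^ s ≠ 0 := pow_ne_zero _ (expChar_pos K p).ne'
  have hconst : ∀ m, ∑ k, c (k + m) * c k ^ p ^ s = ∑ k, c k * c k ^ p ^ s := by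
    intro m
    have hmem : (fun k => c (k + m)) - c ∈ evenLike K α S i := by
      refine ⟨Submodule.sub_mem _ (comp_add_mem_cyclicCode hα hc m) hc, ?_⟩
      have := Equiv.sum_comp (Equiv.addRight m) c
      simp only [Equiv.coe_addRight] at this
      simp [this]
    have := hC hmem c hc
    simpa [sub_mul, sub_eq_zero] using this
  have hne : ∑ k, c k * c k ^ p ^ s ≠ 0 := by
    intro h0
    have h1 : ∑ m, ∑ k, c (k + m) * c k ^ p ^ s = 0 :=
      Finset.sum_eq_zero fun m _ => (hconst m).trans h0
    rw [Finset.sum_comm] at h1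
    have h2 : ∀ k, ∑ m, c (k + m) = ∑ m, c m := fun k => Equiv.sum_comp (Equiv.addLeft k) c
    simp only [← Finset.sum_mul, h2, ← Finset.mul_sum] at h1
    rw [← sum_pow_char_pow] at h1
    exact (mul_ne_zero hsum (pow_ne_zero _ hsum)) h1
  have := card_le_hammingNorm_of_autocorrelation (c := c) (c' := fun k => c k ^ p ^ s)
    (fun i h h0 => h (by simp only [h0, zero_pow hq])) (fun m => by rw [hconst m]; exact hne)
  rwa [ZMod.card] at this

end SquareRootBound

/-! ### The trace character and the error operators -/

section TraceCharacter

variable (p : ℕ) [Fact p.Prime] {F : Type*} [Field F] [Algebra (ZMod p) F]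

/-- The additive character `x ↦ exp (2πi tr(x) / p)` of `F`. -/
noncomputable def traceChar (F : Type*) [Field F] [Algebra (ZMod p) F] : AddChar F ℂ :=
  (ZMod.stdAddChar (N := p)).compAddMonoidHom (Algebra.trace (ZMod p) F).toAddMonoidHom

lemma traceChar_apply (x : F) :
    traceChar p F x = ZMod.stdAddChar (Algebra.trace (ZMod p) F x) := rfl

lemma traceChar_eq_one_iff (x : F) :
    traceChar p F x = 1 ↔ Algebra.trace (ZMod p) F x = 0 := by
  rw [traceChar_apply, ← AddChar.map_zero_eq_one (ZMod.stdAddChar (N := p))]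
  exact ZMod.injective_stdAddChar.eq_iff

end TraceCharacter

section ErrorOperators

variable (p : ℕ) [Fact p.Prime] {F ι : Type*} [Field F] [Fintype F] [Algebra (ZMod p) F]
  [Fintype ι] [DecidableEq ι]

lemma norm_traceChar (x : F) : ‖traceChar p F x‖ = 1 := AddChar.norm_apply _ _

lemma exists_traceChar_mul_ne_one {x : F} (hx : x ≠ 0) : ∃ y, traceChar p F (y * x) ≠ 1 := by
  obtain ⟨z, hz⟩ := Algebra.trace_surjective (ZMod p) F 1
  refine ⟨z * x⁻¹, fun h => ?_⟩
  rw [traceChar_eq_one_iff, inv_mul_cancel_right₀ hx, hz] at h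
  exact one_ne_zero h

lemma errorOp_apply (a b : ι → F) (ψ : States F ι) (y : ι → F) :
    errorOp p a b ψ y = traceChar p F (∑ i, b i * (y i - a i)) * ψ (y - a) := rfl

lemma errorOp_zero : errorOp p (0 : ι → F) 0 = 1 := by
  ext ψ y
  simp [errorOp_apply]

lemma errorOp_mul (a b a' b' : ι → F) :
    errorOp p a b * errorOp p a' b'
      = traceChar p F (∑ i, b i * a' i) • errorOp p (a + a') (b + b') := by
  ext ψ y
  simp only [Module.End.mul_apply, LinearMap.smul_apply, PiLp.smul_apply, smul_eq_mul,
    errorOp_apply, ← mul_assoc, ← AddChar.map_add_eq_mul, ← Finset.sum_add_distrib, sub_sub]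
  congr 2
  refine Finset.sum_congr rfl fun i _ => ?_
  simp only [Pi.add_apply, Pi.sub_apply]
  ring

lemma inner_errorOp_errorOp (a b : ι → F) (ψ φ : States F ι) :
    inner ℂ (errorOp p a b ψ) (errorOp p a b φ) = inner ℂ ψ φ := by
  simp only [PiLp.inner_apply, errorOp_apply]
  rw [← Equiv.sum_comp (Equiv.subRight a) fun y => inner ℂ (ψ y) (φ y)]
  refine Finset.sum_congr rfl fun y _ => ?_
  rw [← smul_eq_mul, ← smul_eq_mul, inner_smul_left, inner_smul_right, ← mul_assoc,
    Complex.conj_mul', norm_traceChar]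
  simp

lemma norm_errorOp (a b : ι → F) (ψ : States F ι) : ‖errorOp p a b ψ‖ = ‖ψ‖ := by
  rw [norm_eq_sqrt_re_inner (𝕜 := ℂ), inner_errorOp_errorOp, ← norm_eq_sqrt_re_inner]

/-- For `a ≠ 0` the matrix has zero diagonal; for `a = 0` the diagonal is a nontrivial character of
`F^n`, which sums to `0`. -/
lemma trace_errorOp {a b : ι → F} (h : a ≠ 0 ∨ b ≠ 0) :
    LinearMap.trace ℂ (States F ι) (errorOp p a b) = 0 := by
  classical
  rw [LinearMap.trace_eq_matrix_trace ℂ (EuclideanSpace.basisFun (ι → F) ℂ).toBasis,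
    Matrix.trace]
  have hdiag : ∀ x : ι → F, (LinearMap.toMatrix (EuclideanSpace.basisFun (ι → F) ℂ).toBasis
      (EuclideanSpace.basisFun (ι → F) ℂ).toBasis (errorOp p a b)).diag x
      = traceChar p F (∑ i, b i * (x i - a i)) * if x - a = x then 1 else 0 := by
    intro x
    simp [LinearMap.toMatrix_apply, errorOp_apply]
  simp only [hdiag]
  by_cases ha : a = 0
  · subst ha
    obtain ⟨i, hi⟩ := Function.ne_iff.1 (h.resolve_left (by simp))
    let ψ : AddChar (ι → F) ℂ :=
      (traceChar p F).compAddMonoidHom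
        ((∑ i, b i • LinearMap.proj i : (ι → F) →ₗ[F] F).toAddMonoidHom)
    have hψ : ∀ x, ψ x = traceChar p F (∑ i, b i * x i) := by
      intro x
      simp [ψ]
    obtain ⟨y, hy⟩ := exists_traceChar_mul_ne_one p (F := F) hi
    have hne : ψ ≠ 1 := by
      intro h1
      refine hy ?_
      have := hψ (Pi.single i y)
      rw [h1] at this
      simpa [Pi.single_apply, mul_comm] using this.symm
    simpa [hψ] using AddChar.sum_eq_zero_of_ne_one hne
  · simp [ha]

lemma trace_errorOp_zero :
    LinearMap.trace ℂ (States F ι) (errorOp p 0 0) = (Fintype.card F : ℂ) ^ Fintype.card ι := by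
  rw [errorOp_zero, LinearMap.trace_one]
  simp

/-- Multiplying by the error with the negated label and taking traces separates distinct labels. -/
lemma eq_of_smul_errorOp_eq {a b a' b' : ι → F} {c c' : ℂ} (hc : c ≠ 0)
    (h : c • errorOp p a b = c' • errorOp p a' b') : a = a' ∧ b = b' := by
  have h1 := congrArg (fun T => LinearMap.trace ℂ (States F ι) (errorOp p (-a) (-b) * T)) h
  by_contra hne
  have hne' : -a + a' ≠ 0 ∨ -b + b' ≠ 0 := by
    by_contra! h0
    exact hne ⟨(neg_add_eq_zero.1 h0.1), neg_add_eq_zero.1 h0.2⟩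
  simp only [mul_smul_comm, errorOp_mul, map_smul, trace_errorOp p hne', neg_add_cancel,
    trace_errorOp_zero, smul_eq_mul, mul_zero] at h1
  refine mul_ne_zero hc (mul_ne_zero ?_ ?_) h1
  · exact (AddChar.val_isUnit _ _).ne_zero
  · exact pow_ne_zero _ (Nat.cast_ne_zero.2 Fintype.card_ne_zero)

end ErrorOperators

/-- Commuting endomorphisms of a nonzero finite-dimensional space over an algebraically closed
field have a common eigenvector. -/
theorem exists_common_eigenvector {κ k V : Type*} [Field k] [IsAlgClosed k] [AddCommGroup V]
    [Module k V] [FiniteDimensional k V] [Nontrivial V] (f : κ → Module.End k V)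
    (hf : ∀ i j, Commute (f i) (f j)) : ∃ v ≠ 0, ∀ i, ∃ μ : k, f i v = μ • v := by
  -- In a minimal nonzero invariant subspace `N`, each eigenspace of `f i` is again invariant by
  -- commutation, so it is all of `N`.
  obtain ⟨N, ⟨hN0, hN⟩, hmin⟩ := wellFounded_lt.has_min
    {N : Submodule k V | N ≠ ⊥ ∧ ∀ i, ∀ x ∈ N, f i x ∈ N} ⟨⊤, top_ne_bot, fun _ _ _ => trivial⟩
  obtain ⟨v, hv, hv0⟩ := N.exists_mem_ne_zero_of_ne_bot hN0
  refine ⟨v, hv0, fun i => ?_⟩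
  have : Nontrivial N := Submodule.nontrivial_iff_ne_bot.2 hN0
  obtain ⟨μ, hμ⟩ := Module.End.exists_eigenvalue ((f i).restrict (hN i))
  obtain ⟨x, hx⟩ := hμ.exists_hasEigenvector
  refine ⟨μ, ?_⟩
  have hle : N ⊓ Module.End.eigenspace (f i) μ ≤ N := inf_le_left
  have heq : N ⊓ Module.End.eigenspace (f i) μ = N := by
    by_contra hne
    refine hmin _ ⟨?_, ?_⟩ (lt_of_le_of_ne hle hne)
    · refine (Submodule.ne_bot_iff _).2 ⟨x, ⟨x.2, ?_⟩, fun h => hx.2 (Subtype.ext h)⟩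
      exact Module.End.mem_eigenspace_iff.2 (congrArg Subtype.val hx.apply_eq_smul)
    · rintro j y ⟨hy, hy'⟩
      refine ⟨hN j y hy, Module.End.mem_eigenspace_iff.2 ?_⟩
      rw [← Module.End.mul_apply, hf i j, Module.End.mul_apply,
        Module.End.mem_eigenspace_iff.1 hy', map_smul]
  rw [← heq] at hv
  exact Module.End.mem_eigenspace_iff.1 hv.2

/-! ### Stabilizer codes from isotropic groups of labels -/

section Stabilizer

variable (p : ℕ) [Fact p.Prime] {F ι : Type*} [Field F] [Fintype F] [Algebra (ZMod p) F]
  [Fintype ι] [DecidableEq ι]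

/-- The symplectic form `⟨(a, b), (a', b')⟩ = b · a' - b' · a`. -/
def sympForm {F ι : Type*} [Field F] [Fintype ι] (x y : (ι → F) × (ι → F)) : F :=
  ∑ i, (x.2 i * y.1 i - y.2 i * x.1 i)

lemma errorOp_mul_comm (x y : (ι → F) × (ι → F)) :
    errorOp p x.1 x.2 * errorOp p y.1 y.2
      = traceChar p F (sympForm x y) • (errorOp p y.1 y.2 * errorOp p x.1 x.2) := by
  rw [errorOp_mul, errorOp_mul, smul_smul, ← AddChar.map_add_eq_mul, sympForm,
    Finset.sum_sub_distrib, sub_add_cancel, add_comm x.1, add_comm x.2]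

/-- A representation by error operators, up to phases, of a group `W` of labels. -/
def IsErrorRep {W : AddSubgroup ((ι → F) × (ι → F))}
    (ρ : Multiplicative W →* Module.End ℂ (States F ι)) : Prop :=
  ∀ w : W, ∃ c : ℂ, ‖c‖ = 1 ∧ ρ (Multiplicative.ofAdd w) = c • errorOp p w.1.1 w.1.2

/-- The commuting operators have a common eigenvector, and its eigenvalues obey the same cocycle as
the operators. Dividing by them makes the projective representation a genuine one, with no separate
treatment of `p = 2`. -/
theorem exists_isErrorRep (W : AddSubgroup ((ι → F) × (ι → F)))
    (hW : ∀ x ∈ W, ∀ y ∈ W, traceChar p F (sympForm x y) = 1) :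
    ∃ ρ : Multiplicative W →* Module.End ℂ (States F ι), IsErrorRep p ρ := by
  obtain ⟨v, hv0, hv⟩ := exists_common_eigenvector
    (fun w : W => errorOp p w.1.1 w.1.2) (fun x y => by
      rw [commute_iff_eq, errorOp_mul_comm, hW _ x.2 _ y.2, one_smul])
  choose l hl using hv
  have hnorm : ∀ w, ‖l w‖ = 1 := by
    intro w
    have := norm_errorOp p w.1.1 w.1.2 v
    rw [hl, norm_smul] at this
    exact mul_right_cancel₀ (norm_ne_zero_iff.2 hv0) (this.trans (one_mul _).symm)
  have hl0 : ∀ w, l w ≠ 0 := fun w h => by simpa [h] using hnorm w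
  have hzero : l 0 = 1 := by
    have := hl 0
    change errorOp p 0 0 v = _ at this
    rw [errorOp_zero, Module.End.one_apply] at this
    exact (smul_left_injective ℂ hv0 (by simpa using this)).symm
  have hmul : ∀ x y : W, l x * l y = traceChar p F (∑ i, x.1.2 i * y.1.1 i) * l (x + y) := by
    intro x y
    have := LinearMap.congr_fun (errorOp_mul p x.1.1 x.1.2 y.1.1 y.1.2) v
    have h2 := hl (x + y)
    change errorOp p (x.1.1 + y.1.1) (x.1.2 + y.1.2) v = _ at h2
    rw [Module.End.mul_apply, hl y, map_smul, hl x, LinearMap.smul_apply, h2, smul_smul,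
      smul_smul, mul_comm] at this
    exact smul_left_injective ℂ hv0 this
  refine ⟨
    { toFun := fun w => (l w.toAdd)⁻¹ • errorOp p w.toAdd.1.1 w.toAdd.1.2
      map_one' := ?_
      map_mul' := ?_ }, fun w => ⟨(l w)⁻¹, by rw [norm_inv, hnorm, inv_one], rfl⟩⟩
  · change (l 0)⁻¹ • errorOp p 0 0 = 1
    rw [hzero, errorOp_zero, inv_one, one_smul]
  · intro x y
    change (l (x.toAdd + y.toAdd))⁻¹ •
      errorOp p (x.toAdd.1.1 + y.toAdd.1.1) (x.toAdd.1.2 + y.toAdd.1.2) = _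
    rw [smul_mul_smul_comm, errorOp_mul, smul_smul, ← mul_inv, hmul, mul_inv, mul_right_comm,
      inv_mul_cancel₀ (AddChar.val_isUnit _ _).ne_zero, one_mul]

variable {W : AddSubgroup ((ι → F) × (ι → F))}
  {ρ : Multiplicative W →* Module.End ℂ (States F ι)}

/-- The vectors fixed by a representation. -/
def fixedSpace {G V : Type*} [Monoid G] [AddCommGroup V] [Module ℂ V]
    (ρ : G →* Module.End ℂ V) : Submodule ℂ V where
  carrier := {v | ∀ g, ρ g v = v}
  zero_mem' := fun g => map_zero _
  add_mem' := fun hu hv g => by rw [map_add, hu g, hv g]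
  smul_mem' := fun c v hv g => by rw [map_smul, hv g]

lemma mem_fixedSpace {G V : Type*} [Monoid G] [AddCommGroup V] [Module ℂ V]
    {ρ : G →* Module.End ℂ V} {v : V} : v ∈ fixedSpace ρ ↔ ∀ g, ρ g v = v := Iff.rfl

variable {p}

lemma IsErrorRep.isStabilizedBy (hρ : IsErrorRep p ρ) :
    IsStabilizedBy p ρ.toHomUnits.range (fixedSpace ρ) where
  error := by
    rintro _ ⟨w, rfl⟩
    obtain ⟨c, hc, h⟩ := hρ w.toAdd
    exact ⟨c, _, _, hc, h⟩
  comm := by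
    rintro _ ⟨x, rfl⟩ _ ⟨y, rfl⟩
    rw [← map_mul, mul_comm, map_mul]
  mem_iff := by
    intro v
    constructor
    · rintro hv _ ⟨w, rfl⟩
      exact hv w
    · intro hv w
      exact hv _ ⟨w, rfl⟩

lemma IsErrorRep.exists_mem_range_iff (hρ : IsErrorRep p ρ) (a b : ι → F) :
    (∃ E ∈ ρ.toHomUnits.range, ∃ c : ℂ, ‖c‖ = 1 ∧
      (E : Module.End ℂ (States F ι)) = c • errorOp p a b) ↔ (a, b) ∈ W := by
  constructor
  · rintro ⟨_, ⟨w, rfl⟩, c, hc, h⟩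
    obtain ⟨c', -, h'⟩ := hρ w.toAdd
    have hc0 : c ≠ 0 := by rintro rfl; simp at hc
    obtain ⟨rfl, rfl⟩ := eq_of_smul_errorOp_eq p hc0 (h.symm.trans h')
    exact w.toAdd.2
  · intro h
    obtain ⟨c, hc, h'⟩ := hρ ⟨(a, b), h⟩
    exact ⟨_, ⟨Multiplicative.ofAdd ⟨(a, b), h⟩, rfl⟩, c, hc, h'⟩

/-- The average of a finite representation. -/
noncomputable def average {G V : Type*} [Monoid G] [Fintype G] [AddCommGroup V] [Module ℂ V]
    (ρ : G →* Module.End ℂ V) : Module.End ℂ V :=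
  (Fintype.card G : ℂ)⁻¹ • ∑ g, ρ g

lemma isProj_average {G V : Type*} [Group G] [Fintype G] [AddCommGroup V] [Module ℂ V]
    (ρ : G →* Module.End ℂ V) : LinearMap.IsProj (fixedSpace ρ) (average ρ) where
  map_mem := by
    intro v g
    simp only [average, LinearMap.smul_apply, LinearMap.sum_apply, map_smul, map_sum]
    congr 1
    rw [← Equiv.sum_comp (Equiv.mulLeft g) fun h => ρ h v]
    simp
  map_id := by
    intro v hv
    simp only [average, LinearMap.smul_apply, LinearMap.sum_apply, mem_fixedSpace.1 hv]
    rw [Finset.sum_const, Finset.card_univ, ← Nat.cast_smul_eq_nsmul ℂ, smul_smul,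
      inv_mul_cancel₀ (Nat.cast_ne_zero.2 Fintype.card_ne_zero), one_smul]

lemma IsErrorRep.trace_eq_zero (hρ : IsErrorRep p ρ) {w : Multiplicative W} (hw : w ≠ 1) :
    LinearMap.trace ℂ _ (ρ w) = 0 := by
  obtain ⟨c, -, h⟩ := hρ w.toAdd
  have hne : w.toAdd.1.1 ≠ 0 ∨ w.toAdd.1.2 ≠ 0 := by
    by_contra! h0
    exact hw (Subtype.ext (Prod.ext h0.1 h0.2))
  rw [← ofAdd_toAdd w, h, map_smul, trace_errorOp p hne, smul_zero]

/-- The dimension is the trace of the averaging projection, to which only the identity contributes.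
-/
lemma IsErrorRep.finrank_fixedSpace (hρ : IsErrorRep p ρ) :
    Module.finrank ℂ (fixedSpace ρ) * Nat.card W = Fintype.card F ^ Fintype.card ι := by
  classical
  have : Fintype W := Fintype.ofFinite W
  have h := (isProj_average ρ).trace
  rw [average, map_smul, map_sum, Finset.sum_eq_single 1 (fun w _ hw => hρ.trace_eq_zero hw)
    (by simp), map_one, LinearMap.trace_one, smul_eq_mul,
    inv_mul_eq_iff_eq_mul₀ (Nat.cast_ne_zero.2 Fintype.card_ne_zero)] at h
  have h' : Module.finrank ℂ (States F ι) = Fintype.card F ^ Fintype.card ι := by simp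
  rw [h', Fintype.card_multiplicative] at h
  rw [mul_comm, Nat.card_eq_fintype_card (α := W)]
  exact_mod_cast h.symm

lemma IsErrorRep.detects_of_mem (hρ : IsErrorRep p ρ) {w : (ι → F) × (ι → F)} (hw : w ∈ W) :
    ∃ μ : ℂ, ∀ u ∈ fixedSpace ρ, ‖u‖ = 1 → inner ℂ u (errorOp p w.1 w.2 u) = μ := by
  obtain ⟨c, hc, h⟩ := hρ ⟨w, hw⟩
  refine ⟨c⁻¹, fun u hu hu1 => ?_⟩
  have hc0 : c ≠ 0 := by rintro rfl; simp at hc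
  have hu' := mem_fixedSpace.1 hu (Multiplicative.ofAdd ⟨w, hw⟩)
  rw [h, LinearMap.smul_apply] at hu'
  have : errorOp p w.1 w.2 u = c⁻¹ • u := by rw [eq_inv_smul_iff₀ hc0, hu']
  rw [this, inner_smul_right, inner_self_eq_norm_sq_to_K, hu1]
  simp

lemma IsErrorRep.mul_errorOp (hρ : IsErrorRep p ρ) (x : (ι → F) × (ι → F)) (w : W) :
    errorOp p x.1 x.2 * ρ (Multiplicative.ofAdd w) =
      traceChar p F (sympForm x w) • (ρ (Multiplicative.ofAdd w) * errorOp p x.1 x.2) := by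
  obtain ⟨c, -, h⟩ := hρ w
  rw [h, mul_smul_comm, errorOp_mul_comm, smul_mul_assoc, smul_comm]

lemma IsErrorRep.inner_map_map (hρ : IsErrorRep p ρ) (w : W) (u v : States F ι) :
    inner ℂ (ρ (Multiplicative.ofAdd w) u) (ρ (Multiplicative.ofAdd w) v) = inner ℂ u v := by
  obtain ⟨c, hc, h⟩ := hρ w
  rw [h, LinearMap.smul_apply, LinearMap.smul_apply, inner_smul_left, inner_smul_right,
    inner_errorOp_errorOp, ← mul_assoc, Complex.conj_mul', hc]
  simp

/-- The error moves `u` into an eigenspace of the unitary `ρ w` with eigenvalue other than `1`,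
which is orthogonal to the code. -/
lemma IsErrorRep.inner_eq_zero (hρ : IsErrorRep p ρ) {x : (ι → F) × (ι → F)} {w : W}
    (hw : traceChar p F (sympForm x w) ≠ 1) {u : States F ι} (hu : u ∈ fixedSpace ρ) :
    inner ℂ u (errorOp p x.1 x.2 u) = 0 := by
  have hu' := mem_fixedSpace.1 hu (Multiplicative.ofAdd w)
  have h1 := LinearMap.congr_fun (hρ.mul_errorOp x w) u
  rw [Module.End.mul_apply, hu', LinearMap.smul_apply, Module.End.mul_apply] at h1
  have h2 := hρ.inner_map_map w u (errorOp p x.1 x.2 u)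
  rw [hu'] at h2
  have h3 := congrArg (inner ℂ u) h1
  rw [inner_smul_right, h2] at h3
  have h4 : (traceChar p F (sympForm x w) - 1) * inner ℂ u (errorOp p x.1 x.2 u) = 0 := by
    rw [sub_mul, one_mul, ← h3, sub_self]
  exact (mul_eq_zero.1 h4).resolve_left (sub_ne_zero.2 hw)

lemma inner_eq_const_mul {V : Type*} [NormedAddCommGroup V] [InnerProductSpace ℂ V]
    {Q : Submodule ℂ V} {T : Module.End ℂ V}
    (h : ∀ u ∈ Q, ∀ v ∈ Q, ‖u‖ = 1 → ‖v‖ = 1 → inner ℂ u (T u) = inner ℂ v (T v))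
    (hT : ∀ u ∈ Q, T u ∈ Q) : ∃ μ : ℂ, ∀ u ∈ Q, T u = μ • u := by
  obtain ⟨μ, hμ⟩ : ∃ μ : ℂ, ∀ u ∈ Q, ‖u‖ = 1 → inner ℂ u (T u) = μ := by
    by_cases hex : ∃ v ∈ Q, ‖v‖ = 1
    · obtain ⟨v, hv, hv1⟩ := hex
      exact ⟨_, fun u hu hu1 => h u hu v hv hu1 hv1⟩
    · exact ⟨0, fun u hu hu1 => (hex ⟨u, hu, hu1⟩).elim⟩
  have hμ' : ∀ u ∈ Q, inner ℂ u (T u) = inner ℂ u (μ • u) := by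
    intro u hu
    by_cases hu0 : u = 0
    · simp [hu0]
    obtain ⟨r, e, he, he1, rfl⟩ : ∃ (r : ℂ) (e : V), e ∈ Q ∧ ‖e‖ = 1 ∧ u = r • e := by
      have hn : (‖u‖ : ℂ) ≠ 0 := by simpa using hu0
      refine ⟨‖u‖, (‖u‖ : ℂ)⁻¹ • u, Q.smul_mem _ hu, ?_, ?_⟩
      · rw [norm_smul, norm_inv, Complex.norm_real, norm_norm,
          inv_mul_cancel₀ (norm_ne_zero_iff.2 hu0)]
      · rw [smul_smul, mul_inv_cancel₀ hn, one_smul]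
    have hee : inner ℂ e e = (1 : ℂ) := by rw [inner_self_eq_norm_sq_to_K, he1]; simp
    simp only [map_smul, inner_smul_left, inner_smul_right, hμ e he he1, hee]
    ring
  refine ⟨μ, fun u hu => ?_⟩
  -- Over `ℂ` an operator with vanishing quadratic form is zero.
  have hR : (T.restrict hT - μ • LinearMap.id : Q →ₗ[ℂ] Q) = 0 := by
    rw [← inner_map_self_eq_zero]
    intro x
    rw [← inner_conj_symm, map_eq_zero]
    have := hμ' x x.2
    rw [LinearMap.sub_apply, inner_sub_right, sub_eq_zero]
    exact this
  have := congrArg Subtype.val (LinearMap.congr_fun hR ⟨u, hu⟩)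
  exact sub_eq_zero.1 this

/-- Such an error `E` preserves the code, so detection would make it a scalar `μ` there, that is `E
* P = μ • P` for the projection `P`. The left side has trace `0`, since `x ∉ W` leaves no identity
term; hence `μ = 0`, impossible for an isometry on a nonzero space. -/
lemma IsErrorRep.not_detects (hρ : IsErrorRep p ρ) {x : (ι → F) × (ι → F)} (hx : x ∉ W)
    (hxW : ∀ w ∈ W, traceChar p F (sympForm x w) = 1) :
    ¬ ∀ u ∈ fixedSpace ρ, ∀ v ∈ fixedSpace ρ, ‖u‖ = 1 → ‖v‖ = 1 →
      inner ℂ u (errorOp p x.1 x.2 u) = inner ℂ v (errorOp p x.1 x.2 v) := by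
  classical
  intro h
  have : Fintype W := Fintype.ofFinite W
  obtain ⟨μ, hμ⟩ := inner_eq_const_mul h (fun u hu => by
    rw [mem_fixedSpace] at hu ⊢
    intro w
    have := LinearMap.congr_fun (hρ.mul_errorOp x w.toAdd) u
    rw [hxW _ w.toAdd.2, one_smul, Module.End.mul_apply, Module.End.mul_apply] at this
    exact this.symm.trans (congrArg _ (hu w)))
  have hP := isProj_average ρ
  have hEP : errorOp p x.1 x.2 * average ρ = μ • average ρ := by
    ext1 v
    exact hμ _ (hP.map_mem v)
  have htr := congrArg (LinearMap.trace ℂ (States F ι)) hEP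
  have hpos : Module.finrank ℂ (fixedSpace ρ) ≠ 0 := by
    intro h0
    have := hρ.finrank_fixedSpace
    rw [h0, zero_mul] at this
    exact pow_ne_zero _ Fintype.card_ne_zero this.symm
  have hleft : LinearMap.trace ℂ (States F ι) (errorOp p x.1 x.2 * average ρ) = 0 := by
    rw [average, mul_smul_comm, Finset.mul_sum, map_smul, map_sum, Finset.sum_eq_zero, smul_zero]
    intro w _
    obtain ⟨c, -, hc⟩ := hρ w.toAdd
    rw [← ofAdd_toAdd w, hc, mul_smul_comm, errorOp_mul, map_smul, map_smul, trace_errorOp,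
      smul_zero, smul_zero]
    by_contra! h0
    refine hx ?_
    have : x = -w.toAdd.1 := Prod.ext (eq_neg_of_add_eq_zero_left h0.1)
      (eq_neg_of_add_eq_zero_left h0.2)
    rw [this]
    exact W.neg_mem w.toAdd.2
  rw [hleft, map_smul, hP.trace, smul_eq_mul] at htr
  have hμ0 : μ = 0 := (mul_eq_zero.1 htr.symm).resolve_right (Nat.cast_ne_zero.2 hpos)
  have hne : fixedSpace ρ ≠ ⊥ := by
    intro hb
    rw [hb] at hpos
    exact hpos (finrank_bot ℂ _)
  obtain ⟨u, hu, hu0⟩ := Submodule.exists_mem_ne_zero_of_ne_bot hne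
  have := norm_errorOp p x.1 x.2 u
  rw [hμ u hu, hμ0, zero_smul, norm_zero] at this
  exact hu0 (norm_eq_zero.1 this.symm)

theorem IsErrorRep.detects_iff (hρ : IsErrorRep p ρ) (x : (ι → F) × (ι → F)) :
    (∀ u ∈ fixedSpace ρ, ∀ v ∈ fixedSpace ρ, ‖u‖ = 1 → ‖v‖ = 1 →
      inner ℂ u (errorOp p x.1 x.2 u) = inner ℂ v (errorOp p x.1 x.2 v)) ↔
      (x ∈ W ∨ ∃ w ∈ W, traceChar p F (sympForm x w) ≠ 1) := by
  constructor
  · intro h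
    by_contra! h'
    exact hρ.not_detects h'.1 h'.2 h
  · rintro (hx | ⟨w, hw, hne⟩) u hu v hv hu1 hv1
    · obtain ⟨μ, hμ⟩ := hρ.detects_of_mem hx
      rw [hμ u hu hu1, hμ v hv hv1]
    · rw [hρ.inner_eq_zero (w := ⟨w, hw⟩) hne hu, hρ.inner_eq_zero (w := ⟨w, hw⟩) hne hv]

end Stabilizer

/-! ### From Hermitian to trace-symplectic duality -/

section HermitianConstruction

variable {p s : ℕ} {F K ι : Type*} [Field F] [Field K] [Algebra F K]

/-- The word `a β + b γ` over `K` with coordinates `a, b` over `F` with respect to `(β, γ)`. -/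
noncomputable def combine (e : Module.Basis (Fin 2) F K) (x : (ι → F) × (ι → F)) : ι → K :=
  fun i => x.1 i • e 0 + x.2 i • e 1

lemma smul_add_smul_eq_zero_iff (e : Module.Basis (Fin 2) F K) {a b : F} :
    a • e 0 + b • e 1 = 0 ↔ a = 0 ∧ b = 0 := by
  refine ⟨fun h => ?_, by rintro ⟨rfl, rfl⟩; simp⟩
  have := Fintype.linearIndependent_iff.1 e.linearIndependent ![a, b] (by simpa using h)
  exact ⟨this 0, this 1⟩

lemma combine_add (e : Module.Basis (Fin 2) F K) (x y : (ι → F) × (ι → F)) :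
    combine e (x + y) = combine e x + combine e y := by
  ext i
  simp only [combine, Prod.fst_add, Prod.snd_add, Pi.add_apply, add_smul]
  abel

lemma combine_smul (e : Module.Basis (Fin 2) F K) (c : F) (x : (ι → F) × (ι → F)) :
    combine e (c • x) = algebraMap F K c • combine e x := by
  ext i
  simp [combine, Algebra.smul_def, mul_add, mul_assoc]

lemma combine_bijective (e : Module.Basis (Fin 2) F K) :
    Function.Bijective (combine (ι := ι) e) := by
  constructor
  · intro x y h
    have h' : ∀ i, x.1 i = y.1 i ∧ x.2 i = y.2 i := by
      intro i
      have := congrFun h i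
      simp only [combine] at this
      rw [← sub_eq_zero, ← sub_eq_zero (a := x.2 i), ← smul_add_smul_eq_zero_iff e, sub_smul,
        sub_smul]
      linear_combination this
    exact Prod.ext (funext fun i => (h' i).1) (funext fun i => (h' i).2)
  · intro c
    refine ⟨(fun i => e.repr (c i) 0, fun i => e.repr (c i) 1), funext fun i => ?_⟩
    have := e.sum_repr (c i)
    rwa [Fin.sum_univ_two] at this

lemma sympForm_smul_right [Fintype ι] (x y : (ι → F) × (ι → F)) (c : F) :
    sympForm x (c • y) = c * sympForm x y := by
  simp only [sympForm, Finset.mul_sum, Prod.smul_fst, Prod.smul_snd, Pi.smul_apply, smul_eq_mul]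
  exact Finset.sum_congr rfl fun i _ => by ring

lemma errorWeight_eq [Fintype ι] [DecidableEq F] [DecidableEq K] (e : Module.Basis (Fin 2) F K)
    (x : (ι → F) × (ι → F)) : errorWeight x.1 x.2 = hammingNorm (combine e x) := by
  unfold errorWeight hammingNorm
  congr 1
  ext i
  simp only [Finset.mem_filter, Finset.mem_univ, true_and, ne_eq, combine,
    smul_add_smul_eq_zero_iff e, Prod.mk_eq_zero]

/-- The coordinate pairs, with respect to the basis `e`, of the words of `C`. -/
noncomputable def coordinates (e : Module.Basis (Fin 2) F K) (C : Submodule K (ι → K)) :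
    AddSubgroup ((ι → F) × (ι → F)) :=
  C.toAddSubgroup.comap (AddMonoidHom.mk' (combine e) (combine_add e))

lemma mem_coordinates {e : Module.Basis (Fin 2) F K} {C : Submodule K (ι → K)}
    {x : (ι → F) × (ι → F)} : x ∈ coordinates e C ↔ combine e x ∈ C := Iff.rfl

lemma card_coordinates (e : Module.Basis (Fin 2) F K) (C : Submodule K (ι → K)) :
    Nat.card (coordinates e C) = Nat.card C :=
  Nat.card_congr ((Equiv.ofBijective _ (combine_bijective e)).subtypeEquiv fun _ => Iff.rfl)

variable [Fintype F]

/-- Antisymmetrizing the Hermitian form leaves an alternating form over `F`, a fixed multiple of the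
symplectic one. -/
lemma sum_mul_pow_sub_eq [Fintype ι] [ExpChar K p] (hF : Fintype.card F = p ^ s)
    (e : Module.Basis (Fin 2) F K) (x y : (ι → F) × (ι → F)) :
    ∑ i, combine e x i * combine e y i ^ p ^ s - ∑ i, combine e y i * combine e x i ^ p ^ s
      = algebraMap F K (sympForm x y) * (e 1 * e 0 ^ p ^ s - e 0 * e 1 ^ p ^ s) := by
  have hpow : ∀ a : F, algebraMap F K a ^ p ^ s = algebraMap F K a := by
    intro a
    rw [← map_pow, ← hF, FiniteField.pow_card]
  rw [← Finset.sum_sub_distrib, sympForm, map_sum, Finset.sum_mul]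
  refine Finset.sum_congr rfl fun i _ => ?_
  simp only [combine, Algebra.smul_def, add_pow_expChar_pow, mul_pow, hpow, map_sub, map_mul]
  ring

lemma exists_algebraMap_eq_of_pow_eq {z : K} (hz : z ^ Fintype.card F = z) :
    ∃ a : F, algebraMap F K a = z := by
  classical
  by_contra! hne
  have hq : 1 < Fintype.card F := Fintype.one_lt_card
  have h0 := FiniteField.X_pow_card_sub_X_ne_zero K hq
  have hsub : insert z (Finset.univ.image (algebraMap F K)) ⊆
      (Polynomial.X ^ Fintype.card F - Polynomial.X : Polynomial K).roots.toFinset := by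
    intro w hw
    have hw' : w ^ Fintype.card F = w := by
      rcases Finset.mem_insert.1 hw with rfl | hw
      · exact hz
      · obtain ⟨a, -, rfl⟩ := Finset.mem_image.1 hw
        rw [← map_pow, FiniteField.pow_card]
    rw [Multiset.mem_toFinset, Polynomial.mem_roots h0]
    simp [hw']
  have h1 := (Finset.card_le_card hsub).trans
    ((Multiset.toFinset_card_le _).trans (Polynomial.card_roots' _))
  rw [FiniteField.X_pow_card_sub_X_natDegree_eq K hq, Finset.card_insert_of_notMem (by simpa using hne),
    Finset.card_image_of_injective _ (algebraMap F K).injective, Finset.card_univ] at h1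
  omega

/-- Otherwise `e 1 / e 0` would be fixed by the `q`-Frobenius and so lie in `F`, against
independence. -/
lemma mul_pow_sub_mul_pow_ne_zero (e : Module.Basis (Fin 2) F K) :
    e 1 * e 0 ^ Fintype.card F - e 0 * e 1 ^ Fintype.card F ≠ 0 := by
  intro h
  have h0 : e 0 ≠ 0 := e.ne_zero 0
  obtain ⟨a, ha⟩ := exists_algebraMap_eq_of_pow_eq (F := F) (z := e 1 / e 0) (by
    rw [div_pow, div_eq_div_iff (pow_ne_zero _ h0) h0]
    linear_combination -h)
  have := (smul_add_smul_eq_zero_iff e (a := a) (b := -1)).1 (by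
    rw [Algebra.smul_def, ha, div_mul_cancel₀ _ h0]; simp)
  exact one_ne_zero (neg_eq_zero.1 this.2)

variable [Fintype ι] [Fintype K]

lemma sympForm_eq_zero_of_mem_hermitianDual [ExpChar K p] (hF : Fintype.card F = p ^ s)
    (hK : Fintype.card K = (p ^ s) ^ 2) (e : Module.Basis (Fin 2) F K) {C : Submodule K (ι → K)}
    {x y : (ι → F) × (ι → F)} (hx : combine e x ∈ hermitianDual (p ^ s) C)
    (hy : combine e y ∈ C) : sympForm x y = 0 := by
  have h1 := hx _ hy
  have h2 := le_hermitianDual_hermitianDual hK C hy _ hx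
  have h3 := sum_mul_pow_sub_eq hF e x y
  rw [h1, h2, sub_zero] at h3
  have h4 := (mul_eq_zero.1 h3.symm).resolve_right (hF ▸ mul_pow_sub_mul_pow_ne_zero e)
  exact (map_eq_zero_iff _ (algebraMap F K).injective).1 h4

variable (p) [Fact p.Prime] [Algebra (ZMod p) F] [ExpChar K p]

/-- Scaling by `F` upgrades triviality of the character to vanishing of the symplectic form, which
says that the Hermitian products with `C` are fixed by the `q`-Frobenius. Scaling by `K` then forces
them to vanish. -/
lemma traceChar_sympForm_eq_one_iff (hF : Fintype.card F = p ^ s)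
    (hK : Fintype.card K = (p ^ s) ^ 2) (e : Module.Basis (Fin 2) F K) (C : Submodule K (ι → K))
    (x : (ι → F) × (ι → F)) :
    (∀ w ∈ coordinates e C, traceChar p F (sympForm x w) = 1) ↔
      combine e x ∈ hermitianDual (p ^ s) C := by
  have hδ : e 1 * e 0 ^ p ^ s - e 0 * e 1 ^ p ^ s ≠ 0 := hF ▸ mul_pow_sub_mul_pow_ne_zero e
  constructor
  · intro h y hy
    have hsymp : ∀ w ∈ coordinates e C, sympForm x w = 0 := by
      intro w hw
      by_contra hne
      obtain ⟨c, hc⟩ := exists_traceChar_mul_ne_one p hne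
      refine hc ?_
      rw [← sympForm_smul_right]
      refine h _ ?_
      rw [mem_coordinates, combine_smul]
      exact C.smul_mem _ hw
    have hfix : ∀ y ∈ C, (∑ i, combine e x i * y i ^ p ^ s) ^ p ^ s
        = ∑ i, combine e x i * y i ^ p ^ s := by
      intro y hy
      obtain ⟨w, rfl⟩ := (combine_bijective e).2 y
      rw [mul_pow_sum_comm hK]
      have := sum_mul_pow_sub_eq hF e x w
      rw [hsymp w hy, map_zero, zero_mul, sub_eq_zero] at this
      exact this.symm
    by_contra hne
    set t := ∑ i, combine e x i * y i ^ p ^ s with ht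
    -- A nonzero product `t` can be scaled to any `z`, so Frobenius would fix all of `K`,
    -- contradicting `hδ`.
    have hall : ∀ z : K, z ^ p ^ s = z := by
      intro z
      obtain ⟨l, hl⟩ : ∃ l : K, l ^ p ^ s = z * t⁻¹ :=
        (Finite.injective_iff_surjective (f := iterateFrobenius K p s)).1
          (iterateFrobenius K p s).injective _
      have := hfix _ (C.smul_mem l hy)
      have hz : ∑ i, combine e x i * (l • y) i ^ p ^ s = z := by
        simp only [Pi.smul_apply, smul_eq_mul, mul_pow, hl, mul_left_comm (combine e x _)]
        rw [← Finset.mul_sum, ← ht, inv_mul_cancel_right₀ hne]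
      rwa [hz] at this
    refine hδ ?_
    rw [hall, hall]
    ring
  · intro h w hw
    rw [sympForm_eq_zero_of_mem_hermitianDual hF hK e h hw, AddChar.map_zero_eq_one]

/-- The stabilizer is labelled by `C`, and the errors commuting with it by `C^⊥ = D`; the basis
turns error weight into Hamming weight. -/
theorem exists_isHermitianConstruction [DecidableEq F] [DecidableEq K] [DecidableEq ι]
    (hF : Fintype.card F = p ^ s) (hK : Fintype.card K = (p ^ s) ^ 2) {C D : Submodule K (ι → K)}
    (hCD : C ≤ D) (hC : hermitianDual (p ^ s) C = D) (hD : hermitianDual (p ^ s) D = C) :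
    ∃ Q : Submodule ℂ (States F ι), IsHermitianConstruction p D Q ∧
      Module.finrank ℂ Q * Nat.card C = Fintype.card F ^ Fintype.card ι ∧
      ∀ d, DetectsBelow p Q d ↔ ∀ c ∈ D, c ∉ C → d ≤ hammingNorm c := by
  have hrank : Module.finrank F K = 2 := by
    have := Module.card_eq_pow_finrank (K := F) (V := K)
    rw [hK, ← hF] at this
    exact (Nat.pow_right_injective (Fintype.one_lt_card (α := F)) this).symm
  let e : Module.Basis (Fin 2) F K := Module.finBasisOfFinrankEq F K hrank
  obtain ⟨ρ, hρ⟩ := exists_isErrorRep p (coordinates e C) fun x hx y hy => by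
    rw [sympForm_eq_zero_of_mem_hermitianDual hF hK e (C := C) (hC ▸ hCD hx) hy,
      AddChar.map_zero_eq_one]
  refine ⟨fixedSpace ρ, ⟨e, _, hρ.isStabilizedBy, fun a b => ?_⟩, ?_, fun d => ?_⟩
  · rw [hρ.exists_mem_range_iff, hF, hD]
    rfl
  · rw [← card_coordinates e, hρ.finrank_fixedSpace]
  · have hdet : ∀ x : (ι → F) × (ι → F), (∀ u ∈ fixedSpace ρ, ∀ v ∈ fixedSpace ρ, ‖u‖ = 1 →
        ‖v‖ = 1 → inner ℂ u (errorOp p x.1 x.2 u) = inner ℂ v (errorOp p x.1 x.2 v)) ↔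
        (combine e x ∈ D → combine e x ∈ C) := by
      intro x
      rw [hρ.detects_iff, ← hC, ← traceChar_sympForm_eq_one_iff p hF hK, mem_coordinates,
        or_comm, imp_iff_not_or]
      push Not
      rfl
    constructor
    · intro h c hc hc'
      by_contra! hlt
      obtain ⟨x, rfl⟩ := (combine_bijective e).2 c
      exact hc' ((hdet x).1 (h x.1 x.2 (by rwa [errorWeight_eq e])) hc)
    · intro h a b hab
      refine (hdet (a, b)).2 fun hx => ?_
      by_contra hx'
      rw [errorWeight_eq e (a, b)] at hab
      exact absurd (h _ hx hx') (not_le.2 hab)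

end HermitianConstruction

end Duadic

/-! ### The main theorem -/

theorem theorem5 (p : ℕ) [Fact p.Prime] (q n : ℕ) [NeZero n]
    {F K L : Type*} [Field F] [Fintype F] [DecidableEq F] [Algebra (ZMod p) F]
    [Field K] [Fintype K] [DecidableEq K] [Algebra F K]
    [Field L] [Algebra K L]
    (hF : Fintype.card F = q) (hK : Fintype.card K = q ^ 2)
    (hn : Odd n) (hnq : Nat.Coprime n q) (hord : Odd (orderOf (q : ZMod n)))
    (α : L) (hα : IsPrimitiveRoot α n) :
    (∃ S : Fin 2 → Set (ZMod n), Duadic.IsSplitting n (q ^ 2) (-(q : ZMod n)) S) ∧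
    ∀ S : Fin 2 → Set (ZMod n), Duadic.IsSplitting n (q ^ 2) (-(q : ZMod n)) S →
      ∀ i : Fin 2,
        Duadic.hermitianDual q (Duadic.evenLike K α S i) = Duadic.oddLike K α S i ∧
        ∃ (Q : Submodule ℂ (Duadic.States F (ZMod n))) (d : ℕ),
          Duadic.IsHermitianConstruction p (Duadic.oddLike K α S i) Q ∧
          Duadic.IsStabilizerCode p Q 1 d ∧
          IsLeast (hammingNorm '' ((Duadic.oddLike K α S i : Set (ZMod n → K)) \
            (Duadic.evenLike K α S i : Set (ZMod n → K)))) d ∧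
          (n : ℤ) ≤ (d : ℤ) ^ 2 - d + 1 := by
  refine ⟨Duadic.exists_isSplitting_neg q n hn hnq hord, fun S hS i => ?_⟩
  have hcharF : CharP F p := charP_of_injective_algebraMap (algebraMap (ZMod p) F).injective p
  have hcharK : CharP K p := charP_of_injective_algebraMap (algebraMap F K).injective p
  have hexp : ExpChar K p := ExpChar.prime Fact.out
  obtain ⟨s, -, hs⟩ := FiniteField.card F p
  obtain rfl : q = p ^ (s : ℕ) := hF.symm.trans hs
  have hn0 : (n : K) ≠ 0 := by
    intro h
    have hpn := (CharP.cast_eq_zero_iff K p n).1 h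
    exact (Fact.out : p.Prime).one_lt.ne' (Nat.dvd_one.1
      (hnq ▸ Nat.dvd_gcd hpn (dvd_pow_self p s.ne_zero)))
  have hnL : (n : L) ≠ 0 := by
    rw [← map_natCast (algebraMap K L)]
    exact (map_ne_zero _).2 hn0
  have hC : Duadic.hermitianDual (p ^ (s : ℕ)) (Duadic.evenLike K α S i) =
      Duadic.oddLike K α S i :=
    Duadic.hermitianDual_evenLike p s hα hnL (hK ▸ hS) i
  have hD : Duadic.hermitianDual (p ^ (s : ℕ)) (Duadic.oddLike K α S i) =
      Duadic.evenLike K α S i := Duadic.hermitianDual_eq_evenLikeSubcode hK hC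
  have hCD : Duadic.evenLike K α S i ≤ Duadic.oddLike K α S i := Duadic.evenLikeSubcode_le _
  -- The all-one word is odd-like because `n ≠ 0` in `K`; it gives the dimension gap and shows that
  -- `D \ C` is nonempty.
  have hone : (fun _ => 1) ∈ Duadic.oddLike K α S i :=
    Duadic.const_one_mem_cyclicCode hα (hS.zero_notMem i)
  have hone0 : ∑ _m : ZMod n, (1 : K) ≠ 0 := by simpa using hn0
  have hrank := Duadic.finrank_hermitianDual_add p s (Duadic.evenLike K α S i)
  have hrank' : Module.finrank K (Duadic.evenLike K α S i) + 1 =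
      Module.finrank K (Duadic.oddLike K α S i) :=
    Duadic.finrank_evenLikeSubcode_add_one hone hone0
  rw [hC, ZMod.card] at hrank
  obtain ⟨Q, hQ, hdim, hdet⟩ := Duadic.exists_isHermitianConstruction p hF hK hCD hC hD
  have hne : (hammingNorm '' ((Duadic.oddLike K α S i : Set (ZMod n → K)) \
      (Duadic.evenLike K α S i : Set (ZMod n → K)))).Nonempty :=
    ⟨_, _, ⟨hone, fun h => hone0 h.2⟩, rfl⟩
  have hleast : IsLeast (hammingNorm '' ((Duadic.oddLike K α S i : Set (ZMod n → K)) \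
      (Duadic.evenLike K α S i : Set (ZMod n → K)))) (sInf _) :=
    ⟨Nat.sInf_mem hne, fun d hd => Nat.sInf_le hd⟩
  refine ⟨hC, Q, _, hQ, ⟨?_, ?_, ?_, ?_⟩, hleast, ?_⟩
  · obtain ⟨_, T, hT, _⟩ := hQ
    exact ⟨T, hT⟩
  · have hcard : Nat.card (Duadic.evenLike K α S i) * Fintype.card F = Fintype.card F ^ n := by
      rw [Module.natCard_eq_pow_finrank (K := K), Nat.card_eq_fintype_card, hK, hF, ← pow_mul,
        ← pow_succ]
      congr 1
      omega
    rw [ZMod.card, ← hcard, mul_comm] at hdim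
    rw [pow_one]
    exact Nat.eq_of_mul_eq_mul_left Nat.card_pos hdim
  · exact (hdet _).2 fun c hc hc' => Nat.sInf_le ⟨c, ⟨hc, hc'⟩, rfl⟩
  · intro d hd
    obtain ⟨c, ⟨hc, hc'⟩, hcd⟩ := hleast.1
    rw [← hcd]
    exact (hdet d).1 hd c hc hc'
  · obtain ⟨c, ⟨hc, hc'⟩, hcd⟩ := hleast.1
    rw [← hcd]
    exact Duadic.card_le_of_mem_oddLike_diff_evenLike p s hα hD.ge hc hc'
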